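/- **Theorem (Sectional Persistence Theorem).** Let $K$ be a field of characteristic $0$ and let $P=K[x_1,\dots,x_n]$ with the standard grading. For a homogeneous ideal $I\subseteq P$, the sectional matrix of $P/I$ is the function $\mathcal M_{P/I}:\{1,\dots,n\}\times\mathbb N\to\mathbb N$, $$\mathcal M_{P/I}(i,d)=\dim\bigl(P_d/(I+(L_1,\dots,L_{n-i}))_d\bigr),$$ where $L_1,\dots,L_{n-i}$ are generic linear forms. That is, $L_k=a_{k1}x_1+\dots+a_{kn}x_n$ with independent indeterminates $a_{kl}$ as coefficients, $P$ and $I$ are extended to $K(a_{kl})[x_1,\dots,x_n]$, and the dimension is taken over $K(a_{kl})$. One says that $\mathcal M_{P/I}$ has $i$-maximal growth in degree $d$ if $$\mathcal M_{P/I}(i,d+1)=\sum_{j=1}^{i}\mathcal M_{P/I}(j,d).$$ Let $I\subseteq P$ be a homogeneous ideal generated by forms of degree $\le\delta+1$, where $\delta\in\mathbb N$. If there exists $i\in\{1,\dots,n\}$ such that $\mathcal M_{P/I}$ has $i$-maximal growth in degree $\delta$, then $\mathcal M_{P/I}$ has $j$-maximal growth in degree $d$ for every $j\in\{1,\dots,i\}$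 and every $d\ge\delta$. -/

import Mathlib

open MvPolynomial

/-- The Hilbert function `d ↦ dim_F (P_d / J_d)` of `P / J`, where `P = F[x_1, …, x_n]` has the
standard grading, `P_d` is the space of forms of degree `d`, and `J_d = J ∩ P_d`. -/
noncomputable def hilbertFn {n : ℕ} {F : Type*} [Field F] (J : Ideal (MvPolynomial (Fin n) F))
    (d : ℕ) : ℕ :=
  Module.finrank F
    (homogeneousSubmodule (Fin n) F d ⧸
      (J.restrictScalars F).comap (homogeneousSubmodule (Fin n) F d).subtype)

/-- The field `K(a_{kl} : 1 ≤ k, l ≤ n)` of rational functions in the coefficients of `n` generic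
linear forms in `n` indeterminates. -/
abbrev GenericField (n : ℕ) (K : Type*) [Field K] : Type _ :=
  FractionRing (MvPolynomial (Fin n × Fin n) K)

/-- The generic linear form `L_k = a_{k1} x_1 + ⋯ + a_{kn} x_n` (`k` is counted from zero). -/
noncomputable def genericForm {n : ℕ} (K : Type*) [Field K] (k : Fin n) :
    MvPolynomial (Fin n) (GenericField n K) :=
  ∑ l : Fin n, C (algebraMap (MvPolynomial (Fin n × Fin n) K) (GenericField n K) (X (k, l))) * X l

/-- The sum of the extension of `I` to `K(a)[x_1, …, x_n]` and the ideal generated by the first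
`m` generic linear forms. -/
noncomputable def genericSection {n : ℕ} {K : Type*} [Field K] (I : Ideal (MvPolynomial (Fin n) K))
    (m : ℕ) : Ideal (MvPolynomial (Fin n) (GenericField n K)) :=
  I.map (MvPolynomial.map (algebraMap K (GenericField n K))) ⊔
    Ideal.span {L | ∃ k : Fin n, (k : ℕ) < m ∧ L = genericForm K k}

/-- The sectional matrix of `P / I`: its entry at `(i, d)`, for `1 ≤ i ≤ n` and `d ∈ ℕ`, is
`dim (P_d / (I + (L_1, …, L_{n-i}))_d)` with `L_1, …, L_{n-i}` generic linear forms. -/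
noncomputable def sectionalMatrix {n : ℕ} {K : Type*} [Field K]
    (I : Ideal (MvPolynomial (Fin n) K)) (i d : ℕ) : ℕ :=
  hilbertFn (genericSection I (n - i)) d

/-- `i`-maximal growth of the sectional matrix of `P / I` in degree `d`. -/
def HasMaximalGrowth {n : ℕ} {K : Type*} [Field K] (I : Ideal (MvPolynomial (Fin n) K))
    (i d : ℕ) : Prop :=
  sectionalMatrix I i (d + 1) = ∑ j ∈ Finset.Icc 1 i, sectionalMatrix I j d

/-- `I` is generated by forms of degree at most `D`. -/
def IsGeneratedInDegreeLE {n : ℕ} {K : Type*} [Field K] (I : Ideal (MvPolynomial (Fin n) K))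
    (D : ℕ) : Prop :=
  ∃ S : Set (MvPolynomial (Fin n) K),
    (∀ f ∈ S, ∃ d ≤ D, f.IsHomogeneous d) ∧ I = Ideal.span S

/-! After the linear change of variables sending `X k` to the generic form `L_{k+1}`, generic
sections become quotients by `J + (x_0, …, x_{k-1})`. The exact sequences given by multiplication by
`X k` telescope: the two sides of the maximal growth equation differ by the sum of the dimensions of
the kernels in degree `d`, over `n - i ≤ k`. So maximal growth means that all these multiplications
are injective (`hilbertFn_eq_sum_iff`); a smaller `j` only asks for fewer values of `k`.

What remains is to pass injectivity from degree `d` to `d + 1` when `J` is generated in degrees at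
most `d + 1` (`InjectiveInDegree.succ`). This is a syzygy argument: a relation `X k * f ≡ ∑ X l * g
l` with `g l ∈ J` is rewritten, eliminating the largest variable each time, until only `X k` is left
and can be cancelled. -/

/-- The ideal generated by the variables of index less than `k`. -/
noncomputable def initialVars (n : ℕ) (F : Type*) [Field F] (k : ℕ) : Ideal (MvPolynomial (Fin n) F) :=
  Ideal.span {p | ∃ j : Fin n, (j : ℕ) < k ∧ p = X j}

/-- An ideal that contains the homogeneous components of its elements. -/
def ComponentClosed {n : ℕ} {F : Type*} [Field F] (J : Ideal (MvPolynomial (Fin n) F)) : Prop :=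
  ∀ f ∈ J, ∀ d, homogeneousComponent d f ∈ J

/-- Multiplication by the `k`-th variable is injective from degree `d` to degree `d + 1` modulo
`J` and the preceding variables. -/
def InjectiveInDegree {n : ℕ} {F : Type*} [Field F] (J : Ideal (MvPolynomial (Fin n) F))
    (k : Fin n) (d : ℕ) : Prop :=
  ∀ f : MvPolynomial (Fin n) F, f.IsHomogeneous d →
    X k * f ∈ J ⊔ initialVars n F k → f ∈ J ⊔ initialVars n F k

/-! ### Homogeneous components and sums of homogeneous ideals. -/

section Components

variable {n : ℕ} {F : Type*} [Field F]

theorem homogeneousComponent_eq_of_isHomogeneous {f : MvPolynomial (Fin n) F} {d : ℕ}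
    (hf : f.IsHomogeneous d) : homogeneousComponent d f = f :=
  homogeneousComponent_eq_self ((mem_homogeneousSubmodule _ _).2 hf)

theorem homogeneousComponent_mul_of_isHomogeneous {s : MvPolynomial (Fin n) F} {b : ℕ}
    (hs : s.IsHomogeneous b) (c : MvPolynomial (Fin n) F) (e : ℕ) :
    homogeneousComponent e (c * s) = if b ≤ e then homogeneousComponent (e - b) c * s else 0 := by
  induction c using MvPolynomial.induction_on' with
  | monomial u r =>
    have hu : (monomial u r : MvPolynomial (Fin n) F).IsHomogeneous u.degree :=
      isHomogeneous_monomial r rfl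
    rw [homogeneousComponent_of_mem ((mem_homogeneousSubmodule _ _).2 (hu.mul hs)),
      homogeneousComponent_of_mem ((mem_homogeneousSubmodule _ _).2 hu)]
    split_ifs <;> first | rfl | omega
  | add p q hp hq =>
    rw [add_mul, map_add, hp, hq, map_add]
    split_ifs <;> ring

theorem componentClosed_span {S : Set (MvPolynomial (Fin n) F)}
    (hS : ∀ f ∈ S, ∃ d, f.IsHomogeneous d) : ComponentClosed (Ideal.span S) := by
  intro f hf d
  induction hf using Submodule.closure_induction with
  | zero => simp
  | add x y _ _ hx hy => rw [map_add]; exact add_mem hx hy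
  | smul_mem r x hx =>
    obtain ⟨b, hb⟩ := hS x hx
    rw [smul_eq_mul, homogeneousComponent_mul_of_isHomogeneous hb]
    split_ifs
    · exact Ideal.mul_mem_left _ _ (Ideal.subset_span hx)
    · exact zero_mem _

theorem componentClosed_initialVars (k : ℕ) : ComponentClosed (initialVars n F k) :=
  componentClosed_span (by rintro _ ⟨j, -, rfl⟩; exact ⟨1, isHomogeneous_X F j⟩)

theorem ComponentClosed.sup {I J : Ideal (MvPolynomial (Fin n) F)} (hI : ComponentClosed I)
    (hJ : ComponentClosed J) : ComponentClosed (I ⊔ J) := by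
  intro f hf d
  obtain ⟨a, ha, b, hb, rfl⟩ := Submodule.mem_sup.1 hf
  rw [map_add]
  exact Submodule.add_mem_sup (hI a ha d) (hJ b hb d)

theorem ComponentClosed.exists_of_mem_sup {I J : Ideal (MvPolynomial (Fin n) F)}
    (hI : ComponentClosed I) (hJ : ComponentClosed J) {f : MvPolynomial (Fin n) F} {d : ℕ}
    (hf : f.IsHomogeneous d) (h : f ∈ I ⊔ J) :
    ∃ a ∈ I, ∃ b ∈ J, a.IsHomogeneous d ∧ b.IsHomogeneous d ∧ f = a + b := by
  obtain ⟨a, ha, b, hb, rfl⟩ := Submodule.mem_sup.1 h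
  refine ⟨_, hI a ha d, _, hJ b hb d, homogeneousComponent_isHomogeneous _ _,
    homogeneousComponent_isHomogeneous _ _, ?_⟩
  rw [← map_add, homogeneousComponent_eq_of_isHomogeneous hf]

theorem ComponentClosed.exists_of_mem_sup_X {I : Ideal (MvPolynomial (Fin n) F)}
    (hI : ComponentClosed I) {l : Fin n} {f : MvPolynomial (Fin n) F} {d : ℕ}
    (hf : f.IsHomogeneous (d + 1)) (h : f ∈ I ⊔ Ideal.span {X l}) :
    ∃ a ∈ I, ∃ b : MvPolynomial (Fin n) F, b.IsHomogeneous d ∧ f = a + X l * b := by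
  obtain ⟨a, ha, b, hb, rfl⟩ := Submodule.mem_sup.1 h
  obtain ⟨c, rfl⟩ := Ideal.mem_span_singleton'.1 hb
  refine ⟨_, hI a ha (d + 1), homogeneousComponent d c, homogeneousComponent_isHomogeneous _ _, ?_⟩
  have := homogeneousComponent_mul_of_isHomogeneous (isHomogeneous_X F l) c (d + 1)
  simp only [le_add_iff_nonneg_left, zero_le, if_true, Nat.add_sub_cancel] at this
  rw [mul_comm (X l), ← this, ← map_add, homogeneousComponent_eq_of_isHomogeneous hf]

end Components

/-! ### Ideals generated by initial segments of the variables. -/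

section InitialVars

variable {n : ℕ} {F : Type*} [Field F]

theorem X_mem_initialVars {j : Fin n} {k : ℕ} (h : (j : ℕ) < k) :
    (X j : MvPolynomial (Fin n) F) ∈ initialVars n F k :=
  Ideal.subset_span ⟨j, h, rfl⟩

theorem initialVars_mono {k l : ℕ} (h : k ≤ l) : initialVars n F k ≤ initialVars n F l :=
  Ideal.span_mono (by rintro _ ⟨j, hj, rfl⟩; exact ⟨j, hj.trans_le h, rfl⟩)

theorem initialVars_succ (k : Fin n) :
    initialVars n F (k + 1) = initialVars n F k ⊔ Ideal.span {X k} := by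
  apply le_antisymm
  · refine Ideal.span_le.2 ?_
    rintro _ ⟨j, hj, rfl⟩
    rcases (Nat.lt_succ_iff.1 hj).lt_or_eq with h | h
    · exact Ideal.mem_sup_left (X_mem_initialVars h)
    · obtain rfl := Fin.ext h
      exact Ideal.mem_sup_right (Ideal.mem_span_singleton_self _)
  · refine sup_le (initialVars_mono (Nat.le_succ _)) ?_
    rw [Ideal.span_singleton_le_iff_mem]
    exact X_mem_initialVars (Nat.lt_succ_self _)

/-- Membership in this monomial ideal is tested on monomials, and the extra factor `X l` is not one
of its generators. -/
theorem mem_initialVars_of_X_mul_mem {l : Fin n} {k : ℕ} (hk : k ≤ l)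
    {f : MvPolynomial (Fin n) F} (h : X l * f ∈ initialVars n F k) : f ∈ initialVars n F k := by
  have hset : {p | ∃ j : Fin n, (j : ℕ) < k ∧ p = X j} =
      (X '' {j : Fin n | (j : ℕ) < k} : Set (MvPolynomial (Fin n) F)) := by
    ext p
    simp [eq_comm]
  rw [initialVars, hset, mem_ideal_span_X_image] at h ⊢
  intro m hm
  obtain ⟨i, hi, hne⟩ := h (Finsupp.single l 1 + m) (by
    rw [mem_support_iff, coeff_X_mul]
    exact mem_support_iff.1 hm)
  have hil : l ≠ i := by
    rintro rfl
    exact absurd hi (not_lt.2 hk)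
  exact ⟨i, hi, by simpa [Finsupp.single_apply, hil] using hne⟩

end InitialVars

/-! ### Persistence of injectivity by elimination of variables. -/

section Persistence

variable {n : ℕ} {F : Type*} [Field F]

theorem exists_sum_X_mul_of_mem_span {S : Set (MvPolynomial (Fin n) F)} {e : ℕ}
    (hS : ∀ s ∈ S, ∃ b ≤ e, s.IsHomogeneous b) {f : MvPolynomial (Fin n) F}
    (hf : f ∈ Ideal.span S) :
    ∃ g : Fin n → MvPolynomial (Fin n) F,
      (∀ l, g l ∈ Ideal.span S ∧ (g l).IsHomogeneous e) ∧
        homogeneousComponent (e + 1) f = ∑ l, X l * g l := by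
  classical
  have hzero : ∃ g : Fin n → MvPolynomial (Fin n) F,
      (∀ l, g l ∈ Ideal.span S ∧ (g l).IsHomogeneous e) ∧ 0 = ∑ l, X l * g l :=
    ⟨0, fun l => ⟨zero_mem _, isHomogeneous_zero _ _ _⟩, by simp⟩
  have hadd : ∀ p q : MvPolynomial (Fin n) F,
      (∃ g : Fin n → MvPolynomial (Fin n) F,
        (∀ l, g l ∈ Ideal.span S ∧ (g l).IsHomogeneous e) ∧ p = ∑ l, X l * g l) →
      (∃ g : Fin n → MvPolynomial (Fin n) F,
        (∀ l, g l ∈ Ideal.span S ∧ (g l).IsHomogeneous e) ∧ q = ∑ l, X l * g l) →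
      ∃ g : Fin n → MvPolynomial (Fin n) F,
        (∀ l, g l ∈ Ideal.span S ∧ (g l).IsHomogeneous e) ∧ p + q = ∑ l, X l * g l := by
    rintro _ _ ⟨g, hg, rfl⟩ ⟨g', hg', rfl⟩
    exact ⟨g + g', fun l => ⟨add_mem (hg l).1 (hg' l).1, (hg l).2.add (hg' l).2⟩,
      by simp [mul_add, Finset.sum_add_distrib]⟩
  induction hf using Submodule.closure_induction with
  | zero => simpa using hzero
  | add x y _ _ hx hy => rw [map_add]; exact hadd _ _ hx hy
  | smul_mem r s hs =>
    obtain ⟨b, hbe, hb⟩ := hS s hs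
    rw [smul_eq_mul]
    induction r using MvPolynomial.induction_on' with
    | add p q hp hq => rw [add_mul, map_add]; exact hadd _ _ hp hq
    | monomial u r =>
      have hu : (monomial u r * s).IsHomogeneous (u.degree + b) :=
        (isHomogeneous_monomial r rfl).mul hb
      rw [homogeneousComponent_of_mem ((mem_homogeneousSubmodule _ _).2 hu)]
      split_ifs with hdeg
      -- The generator has degree at most `e` and the product has degree `e + 1`, so the monomial is
      -- not constant and a variable can be split off.
      · obtain ⟨l, hl⟩ : ∃ l, u l ≠ 0 := by
          by_contra! hcon
          have : u = 0 := Finsupp.ext hcon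
          simp [this] at hdeg
          omega
        have hsplit : u = Finsupp.single l 1 + (u - Finsupp.single l 1) := by
          rw [add_tsub_cancel_of_le]
          simpa [Nat.one_le_iff_ne_zero] using hl
        have hdeg' : u.degree = 1 + (u - Finsupp.single l 1).degree := by
          conv_lhs => rw [hsplit, map_add, Finsupp.degree_single]
        refine ⟨Pi.single l (monomial (u - Finsupp.single l 1) r * s), fun j => ?_, ?_⟩
        · rcases eq_or_ne j l with rfl | hj
          · rw [Pi.single_eq_same]
            refine ⟨Ideal.mul_mem_left _ _ (Ideal.subset_span hs), ?_⟩
            have := (isHomogeneous_monomial (R := F) r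
              (rfl : (u - Finsupp.single j 1).degree = _)).mul hb
            convert this using 1
            omega
          · rw [Pi.single_eq_of_ne hj]
            exact ⟨zero_mem _, isHomogeneous_zero _ _ _⟩
        · rw [Finset.sum_eq_single l (fun j _ hj => by rw [Pi.single_eq_of_ne hj, mul_zero])
            (by simp), Pi.single_eq_same, ← mul_assoc, X, monomial_mul, one_mul, ← hsplit]
      · exact hzero

/-- A form of degree `d + 1` in `J` that lies in the ideal of the first `l` variables is, modulo
the first `m` variables, a combination of these variables with coefficients in `J`. -/
theorem exists_sum_X_mul_of_mem_initialVars {J : Ideal (MvPolynomial (Fin n) F)}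
    (hJ : ComponentClosed J) {m d : ℕ} (hinj : ∀ k : Fin n, m ≤ k → InjectiveInDegree J k d)
    {l : ℕ} (hl : l ≤ n) {g : MvPolynomial (Fin n) F} (hgJ : g ∈ J)
    (hg : g.IsHomogeneous (d + 1)) (hgl : g ∈ initialVars n F l) :
    ∃ p : Fin n → MvPolynomial (Fin n) F, (∀ j, p j ∈ J ∧ (p j).IsHomogeneous d) ∧
      g - ∑ j : Fin n with j.val < l, X j * p j ∈ initialVars n F m := by
  classical
  induction l generalizing g with
  | zero =>
    refine ⟨0, fun j => ⟨zero_mem _, isHomogeneous_zero _ _ _⟩, ?_⟩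
    simpa using initialVars_mono (Nat.zero_le m) hgl
  | succ l ih =>
    rcases Nat.lt_or_ge l m with hlm | hml
    · refine ⟨0, fun j => ⟨zero_mem _, isHomogeneous_zero _ _ _⟩, ?_⟩
      simpa using initialVars_mono hlm hgl
    obtain ⟨k, rfl⟩ : ∃ k : Fin n, (k : ℕ) = l := ⟨⟨l, hl⟩, rfl⟩
    rw [initialVars_succ] at hgl
    obtain ⟨a, ha, h, hh, rfl⟩ := (componentClosed_initialVars (k : ℕ)).exists_of_mem_sup_X hg hgl
    -- Since `a` lies in the ideal of the earlier variables, injectivity in degree `d` strips `X k`.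
    -- The part `q` of `h` in `J` becomes the coefficient of `X k`; the remainder involves only
    -- earlier variables.
    have hmem : h ∈ J ⊔ initialVars n F k := by
      refine hinj k hml h hh ?_
      have : X k * h = (a + X k * h) + -a := by ring
      rw [this]
      exact Submodule.add_mem_sup hgJ (neg_mem ha)
    obtain ⟨q, hq, b, hb, hqd, -, rfl⟩ :=
      hJ.exists_of_mem_sup (componentClosed_initialVars (k : ℕ)) hh hmem
    have hXq : (X k * q).IsHomogeneous (d + 1) := by
      rw [add_comm d]
      exact (isHomogeneous_X F k).mul hqd
    obtain ⟨p, hp, hpm⟩ := ih (by omega) (g := a + X k * (q + b) - X k * q)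
      (sub_mem hgJ (Ideal.mul_mem_left _ _ hq)) (hg.sub hXq) (by
        have : a + X k * (q + b) - X k * q = a + X k * b := by ring
        rw [this]
        exact add_mem ha (Ideal.mul_mem_left _ _ hb))
    refine ⟨Function.update p k q, fun j => ?_, ?_⟩
    · rcases eq_or_ne j k with rfl | hj
      · rw [Function.update_self]
        exact ⟨hq, hqd⟩
      · rw [Function.update_of_ne hj]
        exact hp j
    · have hset : (Finset.univ.filter fun j : Fin n => (j : ℕ) < k + 1) =
          insert k (Finset.univ.filter fun j : Fin n => (j : ℕ) < k) := by
        ext j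
        simp only [Finset.mem_filter, Finset.mem_univ, true_and, Finset.mem_insert, Fin.ext_iff]
        omega
      rw [hset, Finset.sum_insert (by simp), Function.update_self, ← sub_sub,
        Finset.sum_congr rfl (g := fun j => X j * p j)]
      · exact hpm
      · intro j hj
        rw [Function.update_of_ne]
        rintro rfl
        simp at hj

/-- The bound on the generators lets the `J`-part of `X k * f` be written with coefficients in `J`
of degree `d + 1`, exactly the degree in which degree-`d` injectivity can rewrite them. -/
theorem InjectiveInDegree.succ {S : Set (MvPolynomial (Fin n) F)} {m d : ℕ}
    (hS : ∀ s ∈ S, ∃ b ≤ d + 1, s.IsHomogeneous b)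
    (hinj : ∀ k : Fin n, m ≤ k → InjectiveInDegree (Ideal.span S) k d)
    (k : Fin n) (hmk : m ≤ k) : InjectiveInDegree (Ideal.span S) k (d + 1) := by
  classical
  intro f hf hmem
  have hJ : ComponentClosed (Ideal.span S) :=
    componentClosed_span fun s hs => (hS s hs).imp fun _ h => h.2
  -- Here `t` counts the eliminated variables; `t = n - (k + 1)` leaves only the indices up to `k`.
  have key : ∀ t : ℕ, t ≤ n - (k + 1) → ∃ g : Fin n → MvPolynomial (Fin n) F,
      (∀ l, g l ∈ Ideal.span S ∧ (g l).IsHomogeneous (d + 1)) ∧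
        X k * f - ∑ l : Fin n with l.val < n - t, X l * g l ∈ initialVars n F k := by
    intro t
    induction t with
    | zero =>
      intro _
      have hXf : (X k * f).IsHomogeneous (d + 1 + 1) := by
        rw [add_comm (d + 1) 1]
        exact (isHomogeneous_X F k).mul hf
      obtain ⟨a, ha, b, hb, had, -, hab⟩ :=
        hJ.exists_of_mem_sup (componentClosed_initialVars (k : ℕ)) hXf hmem
      obtain ⟨g, hg, hsum⟩ := exists_sum_X_mul_of_mem_span hS ha
      refine ⟨g, hg, ?_⟩
      rw [homogeneousComponent_eq_of_isHomogeneous had] at hsum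
      simpa [hab, ← hsum] using hb
    | succ t ih =>
      intro ht
      obtain ⟨g, hg, hmem⟩ := ih (by omega)
      obtain ⟨l, hl⟩ : ∃ l : Fin n, (l : ℕ) = n - (t + 1) := ⟨⟨n - (t + 1), by omega⟩, rfl⟩
      have hkl : (k : ℕ) < l := by omega
      have hset : (Finset.univ.filter fun j : Fin n => (j : ℕ) < n - t) =
          insert l (Finset.univ.filter fun j : Fin n => (j : ℕ) < l) := by
        ext j
        simp only [Finset.mem_filter, Finset.mem_univ, true_and, Finset.mem_insert, Fin.ext_iff]
        omega
      rw [hset, Finset.sum_insert (by simp)] at hmem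
      -- All other terms, including `X k * f` as `k < l`, lie in the ideal of the variables before
      -- `l`; hence so does `X l * g l`, and `X l` cancels.
      have hgl : g l ∈ initialVars n F l := by
        refine mem_initialVars_of_X_mul_mem le_rfl ?_
        have h1 := initialVars_mono hkl.le hmem
        have h2 : X k * f - ∑ j : Fin n with j.val < l.val, X j * g j ∈ initialVars n F l :=
          sub_mem (Ideal.mul_mem_right _ _ (X_mem_initialVars hkl)) (sum_mem fun j hj =>
            Ideal.mul_mem_right _ _ (X_mem_initialVars (by simpa using hj)))
        have h3 := sub_mem h2 h1
        convert h3 using 1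
        ring
      obtain ⟨p, hp, hpm⟩ := exists_sum_X_mul_of_mem_initialVars hJ hinj l.2.le (hg l).1 (hg l).2 hgl
      -- Substituting `g l ≡ ∑ X j * p j` turns `X l * g l` into terms `X j * (X l * p j)` with `j <
      -- l`, absorbed in the earlier coefficients.
      refine ⟨fun j => g j + X l * p j, fun j => ⟨add_mem (hg j).1
        (Ideal.mul_mem_left _ _ (hp j).1), (hg j).2.add ?_⟩, ?_⟩
      · rw [add_comm d]
        exact (isHomogeneous_X F l).mul (hp j).2
      · rw [← hl]
        have h4 := add_mem hmem
          (Ideal.mul_mem_left _ (X l) (initialVars_mono (F := F) hmk hpm))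
        convert h4 using 1
        simp only [mul_add, mul_sub, Finset.sum_add_distrib, Finset.mul_sum]
        rw [Finset.sum_congr rfl fun j _ => mul_left_comm (X j) (X l) (p j)]
        ring
  obtain ⟨g, hg, hmem'⟩ := key (n - (k + 1)) le_rfl
  have hset : (Finset.univ.filter fun j : Fin n => (j : ℕ) < n - (n - (k + 1))) =
      insert k (Finset.univ.filter fun j : Fin n => (j : ℕ) < k) := by
    ext j
    simp only [Finset.mem_filter, Finset.mem_univ, true_and, Finset.mem_insert, Fin.ext_iff]
    omega
  rw [hset, Finset.sum_insert (by simp)] at hmem'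
  have hsub : f - g k ∈ initialVars n F k := by
    refine mem_initialVars_of_X_mul_mem le_rfl ?_
    have h2 : ∑ j : Fin n with j.val < k.val, X j * g j ∈ initialVars n F k :=
      sum_mem fun j hj => Ideal.mul_mem_right _ _ (X_mem_initialVars (by simpa using hj))
    convert add_mem hmem' h2 using 1
    ring
  have := Submodule.add_mem_sup (hg k).1 hsub
  rwa [add_sub_cancel] at this

end Persistence

/-! ### Hilbert functions and kernels of multiplication by variables. -/

section HilbertFunction

variable {n : ℕ} {F : Type*} [Field F]

theorem finite_homogeneousSubmodule (d : ℕ) :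
    Module.Finite F (homogeneousSubmodule (Fin n) F d) :=
  Module.Finite.iff_fg.2 (homogeneousSubmodule_fg (Fin n) F d)

/-- The forms of degree `d` in the ideal `J`. -/
noncomputable abbrev formsIn (J : Ideal (MvPolynomial (Fin n) F)) (d : ℕ) :
    Submodule F (homogeneousSubmodule (Fin n) F d) :=
  (J.restrictScalars F).comap (homogeneousSubmodule (Fin n) F d).subtype

/-- Multiplication by a variable on forms of degree `d`. -/
noncomputable def mulX (k : Fin n) (d : ℕ) :
    homogeneousSubmodule (Fin n) F d →ₗ[F] homogeneousSubmodule (Fin n) F (d + 1) :=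
  (LinearMap.mulLeft F (X k)).restrict fun f hf => by
    rw [mem_homogeneousSubmodule] at hf ⊢
    rw [add_comm d]
    exact (isHomogeneous_X F k).mul hf

theorem formsIn_le_comap_mulX (J : Ideal (MvPolynomial (Fin n) F)) (k : Fin n) (d : ℕ) :
    formsIn J d ≤ (formsIn J (d + 1)).comap (mulX k d) :=
  fun _ hf => J.mul_mem_left (X k) hf

/-- Multiplication by a variable from degree `d` to degree `d + 1` of the quotient by `J`. -/
noncomputable def mulXQuot (J : Ideal (MvPolynomial (Fin n) F)) (k : Fin n) (d : ℕ) :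
    (homogeneousSubmodule (Fin n) F d ⧸ formsIn J d) →ₗ[F]
      (homogeneousSubmodule (Fin n) F (d + 1) ⧸ formsIn J (d + 1)) :=
  (formsIn J d).mapQ (formsIn J (d + 1)) (mulX k d) (formsIn_le_comap_mulX J k d)

theorem formsIn_sup_X {J : Ideal (MvPolynomial (Fin n) F)} (hJ : ComponentClosed J) (k : Fin n)
    (d : ℕ) : formsIn (J ⊔ Ideal.span {X k}) (d + 1) =
      formsIn J (d + 1) ⊔ LinearMap.range (mulX k d) := by
  apply le_antisymm
  · intro f hf
    obtain ⟨a, ha, b, hb, hab⟩ := hJ.exists_of_mem_sup_X ((mem_homogeneousSubmodule _ _).1 f.2) hf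
    refine Submodule.mem_sup.2 ⟨f - mulX k d ⟨b, hb⟩, ?_, mulX k d ⟨b, hb⟩, ⟨_, rfl⟩, by simp⟩
    have : (f : MvPolynomial (Fin n) F) - X k * b = a := by rw [hab]; ring
    change (f : MvPolynomial (Fin n) F) - X k * b ∈ J
    rwa [this]
  · refine sup_le (fun f hf => Ideal.mem_sup_left hf) ?_
    rintro _ ⟨f, rfl⟩
    exact Ideal.mem_sup_right (Ideal.mul_mem_right _ _ (Ideal.mem_span_singleton_self _))

/-- Rank-nullity for multiplication by `X k` on `P / J`, whose cokernel in degree `d + 1` is that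
degree of `P / (J + (X k))`. -/
theorem hilbertFn_succ_add_finrank_ker {J : Ideal (MvPolynomial (Fin n) F)}
    (hJ : ComponentClosed J) (k : Fin n) (d : ℕ) :
    hilbertFn J (d + 1) + Module.finrank F (LinearMap.ker (mulXQuot J k d)) =
      hilbertFn (J ⊔ Ideal.span {X k}) (d + 1) + hilbertFn J d := by
  have := finite_homogeneousSubmodule (n := n) (F := F) d
  have := finite_homogeneousSubmodule (n := n) (F := F) (d + 1)
  have h1 := LinearMap.finrank_range_add_finrank_ker (mulXQuot J k d)
  have h2 := Submodule.finrank_quotient_add_finrank (LinearMap.range (mulXQuot J k d))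
  have hrange : LinearMap.range (mulXQuot J k d) =
      (formsIn (J ⊔ Ideal.span {X k}) (d + 1)).map (formsIn J (d + 1)).mkQ := by
    rw [formsIn_sup_X hJ, Submodule.map_sup, Submodule.mkQ_map_self, bot_sup_eq, mulXQuot,
      Submodule.range_mapQ]
  have hle : formsIn J (d + 1) ≤ formsIn (J ⊔ Ideal.span {X k}) (d + 1) :=
    fun f hf => Ideal.mem_sup_left hf
  have h3 := (Submodule.quotientQuotientEquivQuotient _ _ hle).finrank_eq
  rw [← hrange] at h3
  change Module.finrank F (homogeneousSubmodule (Fin n) F (d + 1) ⧸ formsIn J (d + 1)) + _ =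
    Module.finrank F (homogeneousSubmodule (Fin n) F (d + 1) ⧸
      formsIn (J ⊔ Ideal.span {X k}) (d + 1)) +
      Module.finrank F (homogeneousSubmodule (Fin n) F d ⧸ formsIn J d)
  rw [← h1, ← h2, h3]
  ring

theorem finrank_ker_mulXQuot_eq_zero_iff (J : Ideal (MvPolynomial (Fin n) F)) (k : Fin n) (d : ℕ) :
    Module.finrank F (LinearMap.ker (mulXQuot (J ⊔ initialVars n F k) k d)) = 0 ↔
      InjectiveInDegree J k d := by
  have := finite_homogeneousSubmodule (n := n) (F := F) d
  rw [Submodule.finrank_eq_zero, Submodule.eq_bot_iff]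
  constructor
  · intro h f hf hmem
    have := h (Submodule.Quotient.mk ⟨f, (mem_homogeneousSubmodule _ _).2 hf⟩) (by
      rw [LinearMap.mem_ker, mulXQuot, Submodule.mapQ_apply,
        Submodule.Quotient.mk_eq_zero]
      exact hmem)
    rwa [Submodule.Quotient.mk_eq_zero] at this
  · intro h x hx
    obtain ⟨f, rfl⟩ := Submodule.Quotient.mk_surjective _ x
    rw [LinearMap.mem_ker, mulXQuot, Submodule.mapQ_apply, Submodule.Quotient.mk_eq_zero] at hx
    rw [Submodule.Quotient.mk_eq_zero]
    exact h f ((mem_homogeneousSubmodule _ _).1 f.2) hx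

theorem hilbertFn_eq_zero_of_X_mem {J : Ideal (MvPolynomial (Fin n) F)} (hJ : ∀ k, X k ∈ J)
    (d : ℕ) : hilbertFn J (d + 1) = 0 := by
  have htop : formsIn J (d + 1) = ⊤ := by
    rw [eq_top_iff]
    rintro ⟨f, hf⟩ -
    rw [mem_homogeneousSubmodule] at hf
    have hle : Ideal.span (X '' (Set.univ : Set (Fin n))) ≤ J := by
      rw [Ideal.span_le]
      rintro _ ⟨k, -, rfl⟩
      exact hJ k
    refine hle (mem_ideal_span_X_image.2 fun u hu => ?_)
    by_contra! hcon
    have hu0 : u = 0 := Finsupp.ext fun i => hcon i trivial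
    have := hf (mem_support_iff.1 hu)
    simp [hu0] at this
  have : Subsingleton (homogeneousSubmodule (Fin n) F (d + 1) ⧸ formsIn J (d + 1)) :=
    Submodule.Quotient.subsingleton_iff.2 htop
  exact Module.finrank_zero_of_subsingleton

/-- Maximal growth amounts to the injectivity of the multiplications by the successive variables. -/
theorem hilbertFn_eq_sum_iff {J : Ideal (MvPolynomial (Fin n) F)} (hJ : ComponentClosed J)
    {i : ℕ} (hi : i ≤ n) (d : ℕ) :
    hilbertFn (J ⊔ initialVars n F (n - i)) (d + 1) =
        ∑ j ∈ Finset.Icc 1 i, hilbertFn (J ⊔ initialVars n F (n - j)) d ↔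
      ∀ k : Fin n, n - i ≤ k → InjectiveInDegree J k d := by
  -- Keeping the kernel dimensions gives an unconditional identity, provable by induction on `i`;
  -- growth is maximal exactly when these natural numbers all vanish.
  suffices h : hilbertFn (J ⊔ initialVars n F (n - i)) (d + 1) +
      ∑ k : Fin n with n - i ≤ k.val,
        Module.finrank F (LinearMap.ker (mulXQuot (J ⊔ initialVars n F k) k d)) =
      ∑ j ∈ Finset.Icc 1 i, hilbertFn (J ⊔ initialVars n F (n - j)) d by
    rw [← h, left_eq_add, Finset.sum_eq_zero_iff]
    simp [finrank_ker_mulXQuot_eq_zero_iff]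
  induction i with
  | zero =>
    have h0 : (Finset.univ.filter fun k : Fin n => n - 0 ≤ k.val) = ∅ := by
      ext k
      simp
    -- For `i = 0` all variables are killed, so nothing survives in the positive degree `d + 1`.
    rw [h0, hilbertFn_eq_zero_of_X_mem]
    · simp
    · exact fun k => Ideal.mem_sup_right (X_mem_initialVars (by simp))
  | succ i ih =>
    obtain ⟨k, hk⟩ : ∃ k : Fin n, (k : ℕ) = n - (i + 1) := ⟨⟨n - (i + 1), by omega⟩, rfl⟩
    have hset : (Finset.univ.filter fun l : Fin n => n - (i + 1) ≤ l.val) =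
        insert k (Finset.univ.filter fun l : Fin n => n - i ≤ l.val) := by
      ext l
      simp only [Finset.mem_filter, Finset.mem_univ, true_and, Finset.mem_insert, Fin.ext_iff]
      omega
    have hrank := hilbertFn_succ_add_finrank_ker
      (hJ.sup (componentClosed_initialVars (F := F) (k : ℕ))) k d
    rw [sup_assoc, ← initialVars_succ, show (k : ℕ) + 1 = n - i by omega] at hrank
    rw [hset, Finset.sum_insert (by simp; omega), Finset.sum_Icc_succ_top (by omega),
      ← ih (by omega), ← hk]
    omega

theorem hilbertFn_map_equiv (e : MvPolynomial (Fin n) F ≃ₐ[F] MvPolynomial (Fin n) F)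
    (he : ∀ d f, f.IsHomogeneous d → (e f).IsHomogeneous d)
    (he' : ∀ d f, f.IsHomogeneous d → (e.symm f).IsHomogeneous d)
    (J : Ideal (MvPolynomial (Fin n) F)) (d : ℕ) : hilbertFn (J.map e) d = hilbertFn J d := by
  let E : homogeneousSubmodule (Fin n) F d ≃ₗ[F] homogeneousSubmodule (Fin n) F d :=
    { (e.toLinearMap.restrict fun f hf => he d f hf :
        homogeneousSubmodule (Fin n) F d →ₗ[F] homogeneousSubmodule (Fin n) F d) with
      invFun := fun f => ⟨e.symm f, he' d f f.2⟩
      left_inv := fun f => Subtype.ext (e.symm_apply_apply _)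
      right_inv := fun f => Subtype.ext (e.apply_symm_apply _) }
  have hE : ∀ f, (E f : MvPolynomial (Fin n) F) = e f := fun _ => rfl
  have hmap : (formsIn J d).map (E : homogeneousSubmodule (Fin n) F d →ₗ[F] _) =
      formsIn (J.map e) d := by
    ext f
    constructor
    · rintro ⟨g, hg, rfl⟩
      exact Ideal.mem_map_of_mem e hg
    · intro hf
      obtain ⟨g, hg, hgf⟩ := (Ideal.mem_map_iff_of_surjective e e.surjective).1 hf
      refine ⟨E.symm f, ?_, E.apply_symm_apply f⟩
      have : ((E.symm f : homogeneousSubmodule (Fin n) F d) : MvPolynomial (Fin n) F) = g := by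
        apply e.injective
        rw [← hE, E.apply_symm_apply, hgf]
        rfl
      change ((E.symm f : homogeneousSubmodule (Fin n) F d) : MvPolynomial (Fin n) F) ∈ J
      rwa [this]
  exact (Submodule.Quotient.equiv _ _ E hmap).finrank_eq.symm

end HilbertFunction

/-! ### The change to generic coordinates. -/

section Coordinates

variable {n : ℕ} {F : Type*} [Field F]

/-- The linear substitution of variables given by a matrix. -/
noncomputable def linearSubst (A : Matrix (Fin n) (Fin n) F) :
    MvPolynomial (Fin n) F →ₐ[F] MvPolynomial (Fin n) F :=
  aeval fun k => ∑ l, C (A k l) * X l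

theorem linearSubst_X (A : Matrix (Fin n) (Fin n) F) (k : Fin n) :
    linearSubst A (X k) = ∑ l, C (A k l) * X l := aeval_X _ _

theorem linearSubst_comp (A B : Matrix (Fin n) (Fin n) F) :
    (linearSubst A).comp (linearSubst B) = linearSubst (B * A) := by
  refine MvPolynomial.algHom_ext fun k => ?_
  simp only [AlgHom.comp_apply, linearSubst_X, map_sum, map_mul, Matrix.mul_apply, algHom_C,
    algebraMap_eq, Finset.mul_sum, Finset.sum_mul]
  rw [Finset.sum_comm]
  simp only [mul_assoc]

theorem linearSubst_one : linearSubst (1 : Matrix (Fin n) (Fin n) F) = AlgHom.id F _ := by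
  refine MvPolynomial.algHom_ext fun k => ?_
  rw [linearSubst_X, Finset.sum_eq_single k]
  · simp
  · intro l _ hl
    simp [Matrix.one_apply_ne hl.symm]
  · simp

theorem linearSubst_isHomogeneous (A : Matrix (Fin n) (Fin n) F) {d : ℕ}
    {f : MvPolynomial (Fin n) F} (hf : f.IsHomogeneous d) : (linearSubst A f).IsHomogeneous d := by
  have := hf.aeval (S := F) (fun k => ∑ l, C (A k l) * X l) (n := 1) fun k =>
    IsHomogeneous.sum _ _ _ fun l _ => isHomogeneous_C_mul_X _ _
  rwa [one_mul] at this

/-- The linear change of variables given by an invertible matrix. -/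
noncomputable def linearSubstEquiv (A : Matrix (Fin n) (Fin n) F) (hA : IsUnit A.det) :
    MvPolynomial (Fin n) F ≃ₐ[F] MvPolynomial (Fin n) F :=
  AlgEquiv.ofAlgHom (linearSubst A) (linearSubst A⁻¹)
    (by rw [linearSubst_comp, Matrix.nonsing_inv_mul _ hA, linearSubst_one])
    (by rw [linearSubst_comp, Matrix.mul_nonsing_inv _ hA, linearSubst_one])

/-- The matrix of coefficients of the generic linear forms. -/
noncomputable def genericMatrix (n : ℕ) (K : Type*) [Field K] :
    Matrix (Fin n) (Fin n) (GenericField n K) :=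
  (algebraMap (MvPolynomial (Fin n × Fin n) K) (GenericField n K)).mapMatrix
    (Matrix.mvPolynomialX (Fin n) (Fin n) K)

theorem isUnit_det_genericMatrix (n : ℕ) (K : Type*) [Field K] :
    IsUnit (genericMatrix n K).det := by
  rw [genericMatrix, ← RingHom.map_det, isUnit_iff_ne_zero, Ne,
    map_eq_zero_iff _ (IsFractionRing.injective _ _)]
  exact Matrix.det_mvPolynomialX_ne_zero (Fin n) K

/-- The change of variables that sends the variables to the generic linear forms. -/
noncomputable def genericCoordinates (n : ℕ) (K : Type*) [Field K] :
    MvPolynomial (Fin n) (GenericField n K) ≃ₐ[GenericField n K]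
      MvPolynomial (Fin n) (GenericField n K) :=
  linearSubstEquiv (genericMatrix n K) (isUnit_det_genericMatrix n K)

theorem genericCoordinates_isHomogeneous {K : Type*} [Field K] {d : ℕ}
    {f : MvPolynomial (Fin n) (GenericField n K)} (hf : f.IsHomogeneous d) :
    (genericCoordinates n K f).IsHomogeneous d :=
  linearSubst_isHomogeneous (genericMatrix n K) hf

theorem genericCoordinates_symm_isHomogeneous {K : Type*} [Field K] {d : ℕ}
    {f : MvPolynomial (Fin n) (GenericField n K)} (hf : f.IsHomogeneous d) :
    ((genericCoordinates n K).symm f).IsHomogeneous d :=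
  linearSubst_isHomogeneous (genericMatrix n K)⁻¹ hf

theorem genericCoordinates_X (K : Type*) [Field K] (k : Fin n) :
    genericCoordinates n K (X k) = genericForm K k :=
  linearSubst_X _ _

theorem genericSection_span {K : Type*} [Field K] (S : Set (MvPolynomial (Fin n) K)) (m : ℕ) :
    genericSection (Ideal.span S) m =
      (Ideal.span ((fun f => (genericCoordinates n K).symm
        (MvPolynomial.map (algebraMap K (GenericField n K)) f)) '' S) ⊔
          initialVars n (GenericField n K) m).map (genericCoordinates n K) := by
  have h1 : (genericCoordinates n K) '' ((fun f => (genericCoordinates n K).symm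
      (MvPolynomial.map (algebraMap K (GenericField n K)) f)) '' S) =
      MvPolynomial.map (algebraMap K (GenericField n K)) '' S := by
    rw [Set.image_image]
    exact Set.image_congr fun f _ => AlgEquiv.apply_symm_apply _ _
  have h2 : {L | ∃ k : Fin n, (k : ℕ) < m ∧ L = genericForm K k} =
      (genericCoordinates n K) '' {p | ∃ j : Fin n, (j : ℕ) < m ∧ p = X j} := by
    ext p
    constructor
    · rintro ⟨k, hk, rfl⟩
      exact ⟨X k, ⟨k, hk, rfl⟩, genericCoordinates_X K k⟩
    · rintro ⟨_, ⟨k, hk, rfl⟩, rfl⟩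
      exact ⟨k, hk, genericCoordinates_X K k⟩
  rw [genericSection, Ideal.map_sup, Ideal.map_span, initialVars, Ideal.map_span, Ideal.map_span,
    h1, h2]

/-- In generic coordinates the generic sections of an ideal become sections by variables. -/
theorem hilbertFn_genericSection {K : Type*} [Field K] (S : Set (MvPolynomial (Fin n) K))
    (m d : ℕ) :
    hilbertFn (genericSection (Ideal.span S) m) d =
      hilbertFn (Ideal.span ((fun f => (genericCoordinates n K).symm
        (MvPolynomial.map (algebraMap K (GenericField n K)) f)) '' S) ⊔
          initialVars n (GenericField n K) m) d := by
  rw [genericSection_span]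
  exact hilbertFn_map_equiv (genericCoordinates n K) (fun _ _ => genericCoordinates_isHomogeneous)
    (fun _ _ => genericCoordinates_symm_isHomogeneous) _ d

end Coordinates

/-! ### Maximal growth as injectivity, and the theorem. -/

theorem hasMaximalGrowth_span_iff {n : ℕ} {K : Type*} [Field K] {S : Set (MvPolynomial (Fin n) K)}
    (hS : ∀ f ∈ S, ∃ d, f.IsHomogeneous d) {i : ℕ} (hi : i ≤ n) (d : ℕ) :
    HasMaximalGrowth (Ideal.span S) i d ↔
      ∀ k : Fin n, n - i ≤ k → InjectiveInDegree (Ideal.span ((fun f =>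
        (genericCoordinates n K).symm
          (MvPolynomial.map (algebraMap K (GenericField n K)) f)) '' S)) k d := by
  rw [← hilbertFn_eq_sum_iff _ hi]
  · simp only [HasMaximalGrowth, sectionalMatrix, hilbertFn_genericSection]
  · refine componentClosed_span ?_
    rintro _ ⟨f, hf, rfl⟩
    exact (hS f hf).imp fun b hb => genericCoordinates_symm_isHomogeneous (hb.map _)

theorem theorem4p3 {K : Type*} [Field K] [CharZero K] {n : ℕ}
    (I : Ideal (MvPolynomial (Fin n) K))
    (hI : letI := MvPolynomial.gradedAlgebra (σ := Fin n) (R := K)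
      I.IsHomogeneous (MvPolynomial.homogeneousSubmodule (Fin n) K))
    (δ : ℕ) (hgen : IsGeneratedInDegreeLE I (δ + 1))
    (i : ℕ) (hi : i ∈ Finset.Icc 1 n) (hgrowth : HasMaximalGrowth I i δ) :
    ∀ j ∈ Finset.Icc 1 i, ∀ d : ℕ, δ ≤ d → HasMaximalGrowth I j d := by
  obtain ⟨S, hS, rfl⟩ := hgen
  have hS' : ∀ f ∈ S, ∃ d, f.IsHomogeneous d := fun f hf => (hS f hf).imp fun _ h => h.2
  rw [Finset.mem_Icc] at hi
  rw [hasMaximalGrowth_span_iff hS' hi.2] at hgrowth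
  intro j hj d hd
  rw [Finset.mem_Icc] at hj
  rw [hasMaximalGrowth_span_iff hS' (hj.2.trans hi.2)]
  -- As `j ≤ i`, the bound `n - j ≤ k` implies `n - i ≤ k`, so it suffices to carry the conditions
  -- for `i` upwards in `d`.
  suffices h : ∀ k : Fin n, n - i ≤ k → InjectiveInDegree (Ideal.span ((fun f =>
      (genericCoordinates n K).symm
        (MvPolynomial.map (algebraMap K (GenericField n K)) f)) '' S)) k d from
    fun k hk => h k (by omega)
  induction d, hd using Nat.le_induction with
  | base => exact hgrowth
  | succ d hd ih =>
    refine InjectiveInDegree.succ ?_ ih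
    rintro _ ⟨f, hf, rfl⟩
    obtain ⟨b, hb, hfb⟩ := hS f hf
    exact ⟨b, by omega, genericCoordinates_symm_isHomogeneous (hfb.map _)⟩
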